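/- Let $M$ be a matroid (not necessarily representable) of rank $d+1$ on the ground set $\{0,\dots,n\}$. Its Bergman fan $\operatorname{trop}(M)\subseteq \mathbb R^{n+1}/\mathbb R\mathbf 1$ is the set of classes of all $w\in\mathbb R^{n+1}$ such that on every circuit of $M$ the minimum of the coordinates of $w$ is attained at least twice (so it is empty if $M$ has a loop). Let $\Sigma$ be the fine subdivision of $\operatorname{trop}(M)$: it consists of the cones in $\operatorname{trop}(M)$ of the form $\operatorname{cone}(\mathbf e_{F_1},\dots,\mathbf e_{F_k})$, where $\emptyset\subsetneq F_1\subsetneq\cdots\subsetneq F_k\subsetneq\{0,\dots,n\}$, $k\ge 0$, is a chain of flats of $M$ and $\mathbf e_F$ denotes the class of the $0/1$ indicator vector of $F$ (if $M$ has no loop, all these cones lie in $\operatorname{trop}(M)$). The facet–ridge hypergraph of $\Sigma$ has as vertices the facets (cones of dimension $\dim\Sigma$) and, for every ridge (cone of dimension $\dim\Sigma-1$), a hyperedge consisting of the facets containing that ridge. A hypergraph is connected if any two of its vertices are joined by a path in which each step connects two vertices of a common hyperedge, and it is $k$-connected if it remains connected after removing any at most $k-1$ vertices together with all hyperedges incident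 to them. Then the facet–ridge hypergraph of $\Sigma$ is $d$-connected. -/

import Mathlib

/-! ### Hypergraphs -/

namespace Hypergraph

variable {α : Type*}

/-- Remove a set `S` of vertices together with all hyperedges incident to a vertex of `S`. -/
def removeVertices (H : Hypergraph α) (S : Set α) : Hypergraph α where
  vertexSet := H.vertexSet \ S
  edgeSet := {e | e ∈ H.edgeSet ∧ Disjoint e S}
  subset_vertexSet_of_mem_edgeSet' := fun _ he _ hx =>
    ⟨H.subset_vertexSet_of_mem_edgeSet' he.1 hx, fun hS => Set.disjoint_left.mp he.2 hx hS⟩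

/-- A hypergraph is connected if there is a path between any two vertices, each step of which
joins two vertices of a common hyperedge. -/
def IsConnected (H : Hypergraph α) : Prop :=
  ∀ x ∈ H.vertexSet, ∀ y ∈ H.vertexSet, Relation.ReflTransGen H.Adj x y

/-- A hypergraph is `k`-connected if it remains connected after removing any at most `k - 1`
vertices and their incident hyperedges. -/
def IsKConnected (H : Hypergraph α) (k : ℕ) : Prop :=
  ∀ S ⊆ H.vertexSet, S.encard < k → (H.removeVertices S).IsConnected

end Hypergraph

/-! ### Facets and ridges of a collection of cones -/

namespace TropicalFan

variable {V : Type*} [AddCommGroup V] [Module ℝ V]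

/-- The dimension of a convex cone: the dimension of its linear span. -/
noncomputable def coneDim (σ : PointedCone ℝ V) : ℕ :=
  Module.finrank ℝ (Submodule.span ℝ (σ : Set V))

/-- The dimension of a fan: the largest dimension of one of its cones. -/
noncomputable def fanDim (Sig : Set (PointedCone ℝ V)) : ℕ :=
  sSup (coneDim '' Sig)

/-- The facets: the cones of dimension `dim Σ`. -/
def facets (Sig : Set (PointedCone ℝ V)) : Set (PointedCone ℝ V) :=
  {σ | σ ∈ Sig ∧ coneDim σ = fanDim Sig}

/-- The ridges: the cones of dimension `dim Σ - 1`. -/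
def ridges (Sig : Set (PointedCone ℝ V)) : Set (PointedCone ℝ V) :=
  {τ | τ ∈ Sig ∧ coneDim τ + 1 = fanDim Sig}

/-- The facet-ridge hypergraph: its vertices are the facets, and every ridge gives the hyperedge
consisting of all facets that contain it. -/
def facetRidgeHypergraph (Sig : Set (PointedCone ℝ V)) : Hypergraph (PointedCone ℝ V) where
  vertexSet := facets Sig
  edgeSet := {e | ∃ τ ∈ ridges Sig, e = {σ | σ ∈ facets Sig ∧ τ ≤ σ}}
  subset_vertexSet_of_mem_edgeSet' := by
    rintro e ⟨τ, _, rfl⟩ σ hσ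
    exact hσ.1

end TropicalFan

/-! ### The Bergman fan of a matroid and its fine subdivision -/

namespace BergmanFan

/-- The space `ℝ^{n+1} / ℝ·(1,…,1)`. -/
abbrev Space (n : ℕ) : Type :=
  (Fin (n + 1) → ℝ) ⧸ Submodule.span ℝ {(1 : Fin (n + 1) → ℝ)}

/-- The quotient map `ℝ^{n+1} → ℝ^{n+1} / ℝ·(1,…,1)`. -/
def proj (n : ℕ) : (Fin (n + 1) → ℝ) →ₗ[ℝ] Space n :=
  (Submodule.span ℝ {(1 : Fin (n + 1) → ℝ)}).mkQ

/-- The class of the `0/1` indicator vector of a set `F`. -/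
noncomputable def ray {n : ℕ} (F : Set (Fin (n + 1))) : Space n :=
  proj n (F.indicator 1)

/-- The cone spanned by the classes of the indicator vectors of the members of `c`. -/
noncomputable def chainCone {n : ℕ} (c : Set (Set (Fin (n + 1)))) : PointedCone ℝ (Space n) :=
  PointedCone.hull ℝ (ray '' c)

/-- The Bergman fan `trop(M)`, as a set: the classes of all `w` such that on every circuit of `M`
the minimum of `w` is attained at least twice. It is empty if `M` has a loop. -/
def trop {n : ℕ} (M : Matroid (Fin (n + 1))) : Set (Space n) :=
  proj n '' {w | ∀ C, M.IsCircuit C →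
    ∃ i ∈ C, ∃ j ∈ C, i ≠ j ∧ w i = w j ∧ ∀ k ∈ C, w i ≤ w k}

/-- The chains of nonempty proper flats of `M`. -/
def IsFlatChain {n : ℕ} (M : Matroid (Fin (n + 1))) (c : Set (Set (Fin (n + 1)))) : Prop :=
  (∀ F ∈ c, M.IsFlat F ∧ F.Nonempty ∧ F ≠ M.E) ∧ IsChain (· ⊆ ·) c

/-- The fine subdivision of the Bergman fan: the cones of the chains of nonempty proper flats.
The requirement that the cone lies in `trop M` holds automatically if `M` has no loop
(`chainCone_subset_trop`); if `M` has a loop it makes the subdivision empty, as is `trop M`. -/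
def fineSubdivision {n : ℕ} (M : Matroid (Fin (n + 1))) : Set (PointedCone ℝ (Space n)) :=
  {σ | ∃ c, IsFlatChain M c ∧ σ = chainCone c ∧ (σ : Set (Space n)) ⊆ trop M}

end BergmanFan

namespace BergmanFan

theorem exists_separating {n : ℕ} {c : Set (Set (Fin (n + 1)))} {x : Space n}
    (hx : x ∈ chainCone c) :
    ∃ w, proj n w = x ∧ ∀ i j, w i < w j → ∃ F ∈ c, j ∈ F ∧ i ∉ F := by
  unfold chainCone PointedCone.hull at hx
  induction hx using Submodule.span_induction with
  | mem x h =>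
    obtain ⟨F, hF, rfl⟩ := h
    refine ⟨F.indicator 1, rfl, fun i j hij => ⟨F, hF, ?_, ?_⟩⟩
    · by_contra hj
      by_cases hi : i ∈ F <;> simp [hi, hj] at hij
      linarith
    · intro hi
      by_cases hj : j ∈ F <;> simp [hi, hj] at hij
      linarith
  | zero => exact ⟨0, map_zero _, fun i j h => absurd h (lt_irrefl _)⟩
  | add x y _ _ hx hy =>
    obtain ⟨w, rfl, hw⟩ := hx
    obtain ⟨v, rfl, hv⟩ := hy
    refine ⟨w + v, map_add _ _ _, fun i j hij => ?_⟩
    by_cases h : w i < w j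
    · exact hw i j h
    · refine hv i j ?_
      simp only [Pi.add_apply] at hij
      linarith
  | smul a x _ hx =>
    obtain ⟨w, rfl, hw⟩ := hx
    refine ⟨(a : ℝ) • w, map_smul _ _ _, fun i j hij => hw i j ?_⟩
    simp only [Pi.smul_apply, smul_eq_mul] at hij
    exact lt_of_mul_lt_mul_left hij a.2

theorem chainCone_subset_trop {n : ℕ} (M : Matroid (Fin (n + 1))) [M.Loopless]
    {c : Set (Set (Fin (n + 1)))} (hc : IsFlatChain M c) :
    (chainCone c : Set (Space n)) ⊆ trop M := by
  intro x hx
  obtain ⟨w, rfl, hw⟩ := exists_separating hx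
  refine ⟨w, fun C hC => ?_, rfl⟩
  obtain ⟨i, hi, hmin⟩ := Set.exists_min_image C w C.toFinite hC.nonempty
  by_contra hcon
  push Not at hcon
  have hlt : ∀ j ∈ C \ {i}, w i < w j := fun j hj => by
    rcases (hmin j hj.1).lt_or_eq with h | h
    · exact h
    · obtain ⟨k, hk, hk'⟩ := hcon i hi j hj.1 (fun h => hj.2 h.symm) h
      exact absurd (hmin k hk) (not_le.mpr hk')
  have hnt : C.Nontrivial := Matroid.loopless_iff_forall_isCircuit.1 inferInstance C hC
  obtain ⟨k, hkC, hki⟩ := hnt.exists_ne i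
  -- a member of the chain that contains the rest of the circuit
  have key : ∀ T : Set (Fin (n + 1)), T.Finite → T ⊆ C \ {i} → T.Nonempty →
      ∃ F ∈ c, T ⊆ F ∧ i ∉ F := by
    intro T hT
    induction T, hT using Set.Finite.induction_on with
    | empty => intro _ h; exact absurd h Set.not_nonempty_empty
    | @insert a T ha hT ih =>
      intro hTC _
      obtain ⟨F, hF, haF, hiF⟩ := hw i a (hlt a (hTC (Set.mem_insert _ _)))
      rcases T.eq_empty_or_nonempty with rfl | hne
      · exact ⟨F, hF, by simpa using haF, hiF⟩
      · obtain ⟨G, hG, hTG, hiG⟩ := ih ((Set.subset_insert _ _).trans hTC) hne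
        rcases hc.2.total hF hG with h | h
        · exact ⟨G, hG, Set.insert_subset (h haF) hTG, hiG⟩
        · exact ⟨F, hF, Set.insert_subset haF (hTG.trans h), hiF⟩
  obtain ⟨F, hF, hCF, hiF⟩ := key _ (Set.toFinite _) subset_rfl ⟨k, hkC, hki⟩
  have h1 := M.closure_subset_closure hCF (hC.mem_closure_sdiff_singleton_of_mem hi)
  rw [(hc.1 F hF).1.closure] at h1
  exact hiF h1

theorem superlevel_isFlat {n : ℕ} (M : Matroid (Fin (n + 1))) (hE : M.E = Set.univ)
    {w : Fin (n + 1) → ℝ} (hw : ∀ C, M.IsCircuit C →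
      ∃ i ∈ C, ∃ j ∈ C, i ≠ j ∧ w i = w j ∧ ∀ k ∈ C, w i ≤ w k) (t : ℝ) :
    M.IsFlat {i | t ≤ w i} := by
  rw [Matroid.isFlat_iff_closure_eq]
  refine Set.Subset.antisymm (fun e he => ?_) (M.subset_closure _ (by simp [hE]))
  by_contra hne
  obtain ⟨C, hC1, hC, heC⟩ := (Matroid.mem_closure_iff_exists_isCircuit hne).1 he
  obtain ⟨i, hi, j, hj, hij, hwij, hmin⟩ := hw C hC
  have h2 := hmin e heC
  have hne' : w e < t := not_le.mp hne
  have : ∀ k ∈ C, w k < t → k = e := fun k hk hkt => by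
    rcases hC1 hk with h | h
    · exact h
    · exact absurd (show t ≤ w k from h) (not_le.mpr hkt)
  exact hij ((this i hi (by linarith)).trans (this j hj (by linarith)).symm)

/-- The cones of the fine subdivision cover the Bergman fan. -/
theorem iUnion_fineSubdivision {n : ℕ} (M : Matroid (Fin (n + 1))) (hE : M.E = Set.univ) :
    ⋃ σ ∈ fineSubdivision M, (σ : Set (Space n)) = trop M := by
  refine Set.Subset.antisymm ?_ ?_
  · simp only [Set.iUnion_subset_iff]
    rintro σ ⟨c, -, -, h⟩
    exact h
  · rintro x ⟨w, hw, rfl⟩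
    have hloop : M.Loopless := by
      rw [Matroid.loopless_iff_forall_isCircuit]
      intro C hC
      obtain ⟨i, hi, j, hj, hij, -⟩ := hw C hC
      exact ⟨i, hi, j, hj, hij⟩
    let c : Set (Set (Fin (n + 1))) := {F | F.Nonempty ∧ F ≠ M.E ∧ ∃ t, F = {i | t ≤ w i}}
    have hc : IsFlatChain M c := by
      refine ⟨?_, ?_⟩
      · rintro F ⟨h1, h2, t, rfl⟩
        exact ⟨superlevel_isFlat M hE hw t, h1, h2⟩
      · rintro F ⟨-, -, t, rfl⟩ G ⟨-, -, s, rfl⟩ -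
        rcases le_total t s with h | h
        · exact Or.inr fun i hi => h.trans hi
        · exact Or.inl fun i hi => h.trans hi
    suffices hmem : proj n w ∈ chainCone c by
      simp only [Set.mem_iUnion]
      exact ⟨_, ⟨c, hc, rfl, chainCone_subset_trop M hc⟩, hmem⟩
    -- induction on the number of values of a function whose superlevel sets are among those of `w`
    have main : ∀ N : ℕ, ∀ v : Fin (n + 1) → ℝ, (Set.range v).ncard ≤ N →
        (∀ t, {i | t ≤ v i} = ∅ ∨ {i | t ≤ v i} = Set.univ ∨ {i | t ≤ v i} ∈ c) →
        proj n v ∈ chainCone c := by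
      intro N
      induction N with
      | zero =>
        intro v hv
        have := (Set.ncard_eq_zero (Set.toFinite _)).1 (Nat.le_zero.1 hv)
        exact absurd this (Set.range_nonempty v).ne_empty
      | succ N ih =>
        intro v hv hlev
        obtain ⟨i0, hi0⟩ := Finite.exists_max v
        by_cases hconst : ∀ i, v i = v i0
        · have : proj n v = 0 := by
            rw [proj, Submodule.mkQ_apply, Submodule.Quotient.mk_eq_zero,
              Submodule.mem_span_singleton]
            exact ⟨v i0, by ext i; simp [hconst i]⟩
          rw [this]; exact zero_mem _
        · push Not at hconst
          have hne : {i | v i ≠ v i0}.Nonempty := hconst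
          obtain ⟨j, hj, hjmax⟩ := Set.exists_max_image _ v (Set.toFinite _) hne
          have hjlt : v j < v i0 := lt_of_le_of_ne (hi0 j) hj
          let T : Set (Fin (n + 1)) := {i | v i0 ≤ v i}
          let v' : Fin (n + 1) → ℝ := fun i => min (v i) (v j)
          have hv'not : ∀ i, i ∉ T → v' i = v i := fun i hi =>
            min_eq_left (hjmax i (fun h => hi h.ge))
          have hv'T : ∀ i, i ∈ T → v' i = v j := fun i hi =>
            min_eq_right (hjlt.le.trans hi)
          have hdec : v = v' + (v i0 - v j) • T.indicator (1 : Fin (n + 1) → ℝ) := by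
            ext i
            by_cases hi : i ∈ T
            · have : v i = v i0 := le_antisymm (hi0 i) hi
              simp [hi, hv'T i hi, this]
            · simp [hi, hv'not i hi]
          have hTc : T ∈ c := by
            rcases hlev (v i0) with h | h | h
            · exact absurd (show i0 ∈ T from le_refl (v i0)) (by rw [show T = ∅ from h]; simp)
            · exact absurd (show j ∈ T by rw [show T = _ from h]; trivial) (not_le.mpr hjlt)
            · exact h
          have h1 : proj n v' ∈ chainCone c := by
            apply ih
            · have hss : Set.range v' ⊂ Set.range v := by
                refine ⟨?_, fun h => ?_⟩
                · rintro _ ⟨i, rfl⟩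
                  rcases min_choice (v i) (v j) with h | h
                  · exact ⟨i, h.symm⟩
                  · exact ⟨j, h.symm⟩
                · obtain ⟨i, hi⟩ := h ⟨i0, rfl⟩
                  have : v' i ≤ v j := min_le_right _ _
                  linarith
              have := Set.ncard_lt_ncard hss
              omega
            · intro t
              by_cases ht : t ≤ v j
              · have : {i | t ≤ v' i} = {i | t ≤ v i} := by
                  ext i; simp [v', ht]
                rw [this]; exact hlev t
              · left
                ext i
                simp [v', ht]
          rw [hdec, map_add, map_smul]
          refine add_mem h1 ?_
          exact (chainCone c).smul_mem (show 0 ≤ v i0 - v j by linarith)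
            (PointedCone.subset_hull ⟨T, hTc, rfl⟩)
    refine main _ w le_rfl fun t => ?_
    by_cases h1 : {i | t ≤ w i} = ∅
    · exact Or.inl h1
    by_cases h2 : {i | t ≤ w i} = Set.univ
    · exact Or.inr (Or.inl h2)
    · exact Or.inr (Or.inr ⟨Set.nonempty_iff_ne_empty.2 h1, by rwa [hE], t, rfl⟩)

end BergmanFan

/-!
The proof separates the geometry of the fan from the combinatorics of the lattice of flats.

*Geometry.* If `M` has a loop, the fan has no cones and there is nothing to prove. Otherwise the
rays of a chain of nonempty proper flats are linearly independent (`linearIndepOn_ray`), and one cone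
of the fan contains another exactly if its chain contains the chain of the other
(`chainCone_le_iff`). So the facets correspond to the complete flags of flats, of length `d`, and
the ridges contained in a facet to the flags with one member left out.

*Combinatorics.* By induction on `d`, for all flats `a` of corank `d + 1`: if a set `S` of fewer
than `d` flags over `a` is removed together with all ridges contained in one of them, the other
flags over `a` stay connected (`Matroid.reflTransGen_flagStep`). The flags through a cover `p` of
`a` form the same structure over `p`, with length `d - 1`, so they are connected by induction as
soon as fewer than `d - 1` members of `S` pass through `p`; call such a `p` good.

* If `p` is not good, all of `S` passes through `p`. A flag `f` through `p` outside `S` can then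
  exchange its bottom member `p` for another cover `q` of `a`: the ridge `f \ {p}` used for this
  lies in no member of `S`, as that member would have to be `f` itself. And `q` is good, because no
  member of `S` passes through it.
* Two good covers `p ≠ q` have a common cover `l`. Exchanging `p` for `q` in some flag through
  `l` is possible unless each ridge `{l} ∪ c`, with `c` a flag over `l`, lies in a member of `S`.
  There are at least `d - 1` such `c` (`Matroid.le_encard_isFlagOver`), so in that case all members
  of `S` pass through `l` (`Matroid.mem_of_forall_isFlagOver`). A cover `t` of `a` not below `l` is
  then good, and nothing obstructs the exchanges of `p` for `t` and of `t` for `q`.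
-/

/-! ### Covers and flags in the lattice of flats -/

namespace Matroid

variable {α : Type*} {M : Matroid α} {a p q l F : Set α} {c : Set (Set α)} {d k : ℕ}

/-- `p` covers `a` in the lattice of flats, written as: `p` is the closure of `a` together with one
further element. -/
def FlatCovers (M : Matroid α) (a p : Set α) : Prop :=
  ∃ e ∈ M.E \ a, p = M.closure (insert e a)

/-- `c` is a chain of `k` flats lying strictly between `a` and the ground set. If `a` is a flat of
corank `k + 1`, this is a complete flag of the interval from `a` to the ground set. That `a` has
corank `k` is expressed as `M.eRk a + k = M.eRank`. -/
structure IsFlagOver (M : Matroid α) (a : Set α) (k : ℕ) (c : Set (Set α)) : Prop where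
  isFlat : ∀ F ∈ c, M.IsFlat F
  ssubset : ∀ F ∈ c, a ⊂ F
  ne_ground : ∀ F ∈ c, F ≠ M.E
  isChain : IsChain (· ⊆ ·) c
  encard_eq : c.encard = k

namespace FlatCovers

theorem isFlat (h : M.FlatCovers a p) : M.IsFlat p := by
  obtain ⟨e, -, rfl⟩ := h
  exact M.isFlat_closure _

theorem ssubset (ha : M.IsFlat a) (h : M.FlatCovers a p) : a ⊂ p := by
  obtain ⟨e, he, rfl⟩ := h
  have hss : insert e a ⊆ M.closure (insert e a) :=
    M.subset_closure _ (Set.insert_subset he.1 ha.subset_ground)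
  exact (Set.ssubset_insert he.2).trans_subset hss

theorem eRk_eq (ha : M.IsFlat a) (h : M.FlatCovers a p) : M.eRk p = M.eRk a + 1 := by
  obtain ⟨e, he, rfl⟩ := h
  rw [eRk_closure_eq, eRk_insert_eq_add_one (by rwa [ha.closure])]

theorem eq_of_ssubset_of_subset (ha : M.IsFlat a) (h : M.FlatCovers a p) (hF : M.IsFlat F)
    (haF : a ⊂ F) (hFp : F ⊆ p) : F = p := by
  obtain ⟨e, he, rfl⟩ := h
  obtain ⟨f, hfF, hfa⟩ := Set.exists_of_ssubset haF
  refine hFp.antisymm ?_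
  rw [← closure_insert_congr (e := f) ⟨hFp hfF, by rwa [ha.closure]⟩]
  calc M.closure (insert f a) ⊆ M.closure F :=
        M.closure_subset_closure (Set.insert_subset hfF haF.subset)
    _ = F := hF.closure

theorem eq_of_subset (ha : M.IsFlat a) (hp : M.FlatCovers a p) (hq : M.FlatCovers a q)
    (hpq : p ⊆ q) : p = q :=
  hq.eq_of_ssubset_of_subset ha hp.isFlat (hp.ssubset ha) hpq

theorem eq_of_mem_isChain (ha : M.IsFlat a) (hp : M.FlatCovers a p) (hq : M.FlatCovers a q)
    (hc : IsChain (· ⊆ ·) c) (hpc : p ∈ c) (hqc : q ∈ c) : p = q := by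
  rcases hc.total hpc hqc with h | h
  · exact hp.eq_of_subset ha hq h
  · exact (hq.eq_of_subset ha hp h).symm

theorem subset_of_mem_isFlagOver (ha : M.IsFlat a) (hp : M.FlatCovers a p)
    (hc : M.IsFlagOver a k c) (hpc : p ∈ c) (hF : F ∈ c) : p ⊆ F := by
  rcases hc.isChain.total hpc hF with h | h
  · exact h
  · exact (hp.eq_of_ssubset_of_subset ha (hc.isFlat F hF) (hc.ssubset F hF) h).ge

theorem corank (ha : M.IsFlat a) (hp : M.FlatCovers a p)
    (hd : M.eRk a + (k + 1 : ℕ) = M.eRank) : M.eRk p + k = M.eRank := by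
  rw [← hd, hp.eRk_eq ha, add_assoc, add_comm 1]
  push_cast
  rfl

end FlatCovers

theorem IsFlat.exists_flatCovers (hF : M.IsFlat F) (haF : a ⊂ F) :
    ∃ p, M.FlatCovers a p ∧ p ⊆ F := by
  obtain ⟨e, heF, hea⟩ := Set.exists_of_ssubset haF
  refine ⟨_, ⟨e, ⟨hF.subset_ground heF, hea⟩, rfl⟩, ?_⟩
  exact hF.closure ▸ M.closure_subset_closure (Set.insert_subset heF haF.subset)

theorem IsFlat.eRk_add_one_le_of_ssubset (ha : M.IsFlat a) (haF : a ⊂ F) (hF : M.IsFlat F) :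
    M.eRk a + 1 ≤ M.eRk F := by
  obtain ⟨p, hp, hpF⟩ := hF.exists_flatCovers haF
  exact hp.eRk_eq ha ▸ M.eRk_mono hpF

/-- Removing a cover of `a` from a flag over `a` leaves a flag over that cover. -/
theorem IsFlagOver.sdiff_singleton (ha : M.IsFlat a) (hp : M.FlatCovers a p)
    (hc : M.IsFlagOver a (k + 1) c) (hpc : p ∈ c) : M.IsFlagOver p k (c \ {p}) := by
  refine ⟨fun F hF => hc.isFlat F hF.1, fun F hF => ?_, fun F hF => hc.ne_ground F hF.1,
    hc.isChain.mono Set.sdiff_subset, ?_⟩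
  · exact (hp.subset_of_mem_isFlagOver ha hc hpc hF.1).ssubset_of_ne fun h => hF.2 h.symm
  · have := Set.encard_sdiff_singleton_add_one hpc
    rw [hc.encard_eq] at this
    exact ENat.add_left_injective_of_ne_top ENat.one_ne_top (by exact_mod_cast this)

theorem IsFlagOver.notMem (hc : M.IsFlagOver p k c) : p ∉ c :=
  fun h => (hc.ssubset p h).ne rfl

theorem IsFlagOver.insert (ha : M.IsFlat a) (hp : M.FlatCovers a p) (hpE : p ≠ M.E)
    (hc : M.IsFlagOver p k c) : M.IsFlagOver a (k + 1) (insert p c) where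
  isFlat F hF := by
    rcases hF with rfl | hF
    exacts [hp.isFlat, hc.isFlat F hF]
  ssubset F hF := by
    rcases hF with rfl | hF
    exacts [hp.ssubset ha, (hp.ssubset ha).trans (hc.ssubset F hF)]
  ne_ground F hF := by
    rcases hF with rfl | hF
    exacts [hpE, hc.ne_ground F hF]
  isChain := hc.isChain.insert fun F hF _ => Or.inl (hc.ssubset F hF).subset
  encard_eq := by
    rw [Set.encard_insert_of_notMem hc.notMem, hc.encard_eq]
    norm_cast

/-- Two covers of `a` have a common cover. -/
theorem FlatCovers.exists_join (ha : M.IsFlat a) (hp : M.FlatCovers a p) (hq : M.FlatCovers a q)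
    (hpq : p ≠ q) : ∃ l, M.FlatCovers p l ∧ M.FlatCovers q l := by
  have hq' := hq
  have hp' := hp
  obtain ⟨e, he, rfl⟩ := hp
  obtain ⟨f, hf, rfl⟩ := hq
  refine ⟨M.closure (Insert.insert e (Insert.insert f a)), ⟨f, ⟨hf.1, fun h => ?_⟩, ?_⟩,
    ⟨e, ⟨he.1, fun h => ?_⟩, ?_⟩⟩
  · refine hpq (hq'.eq_of_subset ha hp' ?_).symm
    rw [← (M.isFlat_closure (Insert.insert e a)).closure]
    exact M.closure_subset_closure (Set.insert_subset h (hp'.ssubset ha).subset)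
  · rw [closure_insert_closure_eq_closure_insert, Set.insert_comm]
  · refine hpq (hp'.eq_of_subset ha hq' ?_)
    rw [← (M.isFlat_closure (Insert.insert f a)).closure]
    exact M.closure_subset_closure (Set.insert_subset h (hq'.ssubset ha).subset)
  · rw [closure_insert_closure_eq_closure_insert]

/-- An interval of length two in the lattice of flats has at least two flats strictly inside. -/
theorem FlatCovers.exists_ne (ha : M.IsFlat a) (hp : M.FlatCovers a p) (hl : M.FlatCovers p l) :
    ∃ q ≠ p, M.FlatCovers a q ∧ M.FlatCovers q l := by
  obtain ⟨f, hf, rfl⟩ := hl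
  have hq : M.FlatCovers a (M.closure (Insert.insert f a)) :=
    ⟨f, ⟨hf.1, fun h => hf.2 ((hp.ssubset ha).subset h)⟩, rfl⟩
  have hne : M.closure (Insert.insert f a) ≠ p := fun h => hf.2
    (h ▸ M.mem_closure_of_mem (Set.mem_insert f a)
      (Set.insert_subset hf.1 ha.subset_ground))
  refine ⟨_, hne, hq, ?_⟩
  have hp' := hp
  obtain ⟨e, he, rfl⟩ := hp'
  refine ⟨e, ⟨he.1, fun h => hne ?_⟩, ?_⟩
  · refine (hp.eq_of_subset ha hq ?_).symm
    rw [← (M.isFlat_closure (Insert.insert f a)).closure]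
    exact M.closure_subset_closure (Set.insert_subset h (hq.ssubset ha).subset)
  · rw [closure_insert_closure_eq_closure_insert, closure_insert_closure_eq_closure_insert,
      Set.insert_comm]

theorem IsFlat.exists_flatCovers_not_subset (ha : M.IsFlat a) (hF : M.IsFlat F) (haF : a ⊆ F)
    (hFE : F ≠ M.E) : ∃ q, M.FlatCovers a q ∧ ¬ q ⊆ F := by
  obtain ⟨e, heE, heF⟩ := Set.exists_of_ssubset (hF.subset_ground.ssubset_of_ne hFE)
  exact ⟨_, ⟨e, ⟨heE, fun h => heF (haF h)⟩, rfl⟩, fun h => heF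
    (h (M.mem_closure_of_mem (Set.mem_insert e a) (Set.insert_subset heE ha.subset_ground)))⟩

/-- A chain of flats strictly between `a` and the ground set has fewer members than the corank
of `a`. -/
theorem IsFlagOver.eRk_add_le (ha : M.IsFlat a) (haE : a ≠ M.E) (hc : M.IsFlagOver a k c) :
    M.eRk a + (k + 1 : ℕ) ≤ M.eRank := by
  induction k generalizing a c with
  | zero =>
    rw [← M.eRk_ground]
    exact mod_cast ha.eRk_add_one_le_of_ssubset (ha.subset_ground.ssubset_of_ne haE) M.ground_isFlat
  | succ k ih =>
    have hfin : c.Finite := Set.finite_of_encard_eq_coe hc.encard_eq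
    have hne : c.Nonempty := by
      rw [← Set.encard_ne_zero, hc.encard_eq]
      exact mod_cast k.succ_ne_zero
    obtain ⟨p, hp⟩ := hfin.exists_minimal hne
    have hflag : M.IsFlagOver p k (c \ {p}) := by
      refine ⟨fun F hF => hc.isFlat F hF.1, fun F hF => ?_, fun F hF => hc.ne_ground F hF.1,
        hc.isChain.mono Set.sdiff_subset, ?_⟩
      · rcases hc.isChain.total hp.prop hF.1 with h | h
        · exact h.ssubset_of_ne fun h' => hF.2 h'.symm
        · exact absurd (h.antisymm (hp.le_of_le hF.1 h)) hF.2
      · have := Set.encard_sdiff_singleton_add_one hp.prop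
        rw [hc.encard_eq] at this
        exact ENat.add_left_injective_of_ne_top ENat.one_ne_top (by exact_mod_cast this)
    refine le_trans ?_ (ih (hc.isFlat p hp.prop) (hc.ne_ground p hp.prop) hflag)
    have h1 := ha.eRk_add_one_le_of_ssubset (hc.ssubset p hp.prop) (hc.isFlat p hp.prop)
    calc M.eRk a + (k + 1 + 1 : ℕ) = M.eRk a + 1 + (k + 1 : ℕ) := by
          push_cast; ring
      _ ≤ _ := by gcongr

variable [M.RankFinite]

theorem ne_ground_of_corank (hd : M.eRk a + (k + 1 : ℕ) = M.eRank) :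
    a ≠ M.E := by
  rintro rfl
  have := (M.isRkFinite_set M.E).eRk_lt_top
  rw [eRk_ground] at hd this
  lift M.eRank to ℕ using this.ne with r
  norm_cast at hd
  omega

theorem IsFlat.ssubset_ground_of_corank (ha : M.IsFlat a)
    (hd : M.eRk a + (k + 1 : ℕ) = M.eRank) : a ⊂ M.E :=
  ha.subset_ground.ssubset_of_ne (ne_ground_of_corank hd)

theorem IsFlagOver.le_of_corank (ha : M.IsFlat a) (hc : M.IsFlagOver a k c)
    (hd : M.eRk a + (d + 1 : ℕ) = M.eRank) : k ≤ d := by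
  have h := hc.eRk_add_le ha (ne_ground_of_corank hd)
  rw [← hd, ENat.add_le_add_iff_left (M.isRkFinite_set a).eRk_lt_top.ne] at h
  norm_cast at h
  omega

theorem IsFlagOver.exists_flatCovers_mem (ha : M.IsFlat a)
    (hd : M.eRk a + (k + 2 : ℕ) = M.eRank) (hc : M.IsFlagOver a (k + 1) c) :
    ∃ p ∈ c, M.FlatCovers a p := by
  have hfin : c.Finite := Set.finite_of_encard_eq_coe hc.encard_eq
  have hne : c.Nonempty := by
    rw [← Set.encard_ne_zero, hc.encard_eq]
    exact mod_cast k.succ_ne_zero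
  obtain ⟨p, hp⟩ := hfin.exists_minimal hne
  obtain ⟨q, hq, hqp⟩ := (hc.isFlat p hp.prop).exists_flatCovers (hc.ssubset p hp.prop)
  refine ⟨p, hp.prop, ?_⟩
  by_cases hqp' : q = p
  · exact hqp' ▸ hq
  -- otherwise `q` could be added to `c`, which would make the chain too long
  have hqc : q ∉ c := fun h => hqp' (hqp.antisymm (hp.le_of_le h hqp))
  have hpF : ∀ F ∈ c, p ⊆ F := fun F hF => by
    rcases hc.isChain.total hp.prop hF with h | h
    exacts [h, hp.le_of_le hF h]
  have hlong : M.IsFlagOver q (k + 1) c :=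
    ⟨hc.isFlat, fun F hF => (hqp.trans (hpF F hF)).ssubset_of_ne fun h => hqc (h ▸ hF),
      hc.ne_ground, hc.isChain, hc.encard_eq⟩
  have := hlong.le_of_corank hq.isFlat (hq.corank ha hd)
  omega

theorem FlatCovers.insert_isFlagOver (ha : M.IsFlat a) (hp : M.FlatCovers a p)
    (hd : M.eRk a + (k + 2 : ℕ) = M.eRank) (hc : M.IsFlagOver p k c) :
    M.IsFlagOver a (k + 1) (Insert.insert p c) :=
  hc.insert ha hp (ne_ground_of_corank (hp.corank ha hd))

theorem exists_isFlagOver (ha : M.IsFlat a) (hd : M.eRk a + (d + 1 : ℕ) = M.eRank) :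
    ∃ c, M.IsFlagOver a d c := by
  induction d generalizing a with
  | zero => exact ⟨∅, by simp, by simp, by simp, by simp, by simp⟩
  | succ d ih =>
    obtain ⟨p, hp, -⟩ := M.ground_isFlat.exists_flatCovers (ha.ssubset_ground_of_corank hd)
    obtain ⟨c, hc⟩ := ih hp.isFlat (hp.corank ha hd)
    exact ⟨_, hp.insert_isFlagOver ha hd hc⟩

/-- The interval above a flat of corank `d + 1` has at least `d + 1` complete flags. -/
theorem le_encard_isFlagOver (ha : M.IsFlat a) (hd : M.eRk a + (d + 1 : ℕ) = M.eRank) :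
    ((d + 1 : ℕ) : ℕ∞) ≤ {c | M.IsFlagOver a d c}.encard := by
  induction d generalizing a with
  | zero =>
    obtain ⟨c, hc⟩ := exists_isFlagOver ha hd
    simpa [Set.one_le_encard_iff_nonempty] using ⟨c, hc⟩
  | succ d ih =>
    obtain ⟨p, hp, -⟩ := M.ground_isFlat.exists_flatCovers (ha.ssubset_ground_of_corank hd)
    have hpd := hp.corank ha hd
    -- the flags through `p`, together with one flag through another cover `q` of `a`
    obtain ⟨q, hq, hqp⟩ := ha.exists_flatCovers_not_subset hp.isFlat (hp.ssubset ha).subset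
      (ne_ground_of_corank hpd)
    obtain ⟨c, hc⟩ := exists_isFlagOver hq.isFlat (hq.corank ha hd)
    have hc' := hq.insert_isFlagOver ha hd hc
    have hinj : Set.InjOn (Insert.insert p) {c | M.IsFlagOver p d c} := by
      intro x hx y hy hxy
      rw [← Set.insert_sdiff_self_of_notMem (IsFlagOver.notMem hx), hxy,
        Set.insert_sdiff_self_of_notMem (IsFlagOver.notMem hy)]
    have hnot : Insert.insert q c ∉ Insert.insert p '' {c | M.IsFlagOver p d c} := by
      rintro ⟨x, hx, hxc⟩
      have hpm : p ∈ Insert.insert q c := hxc ▸ Set.mem_insert p x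
      exact hqp (hp.eq_of_mem_isChain ha hq hc'.isChain hpm (Set.mem_insert q c)).ge
    calc ((d + 1 + 1 : ℕ) : ℕ∞) = (d + 1 : ℕ) + 1 := by push_cast; rfl
      _ ≤ (Insert.insert p '' {c | M.IsFlagOver p d c}).encard + 1 := by
        rw [hinj.encard_image]
        gcongr
        exact ih hp.isFlat hpd
      _ = (Insert.insert (Insert.insert q c)
            (Insert.insert p '' {c | M.IsFlagOver p d c})).encard :=
        (Set.encard_insert_of_notMem hnot).symm
      _ ≤ _ := by
        refine Set.encard_le_encard (Set.insert_subset hc' ?_)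
        rintro _ ⟨x, hx, rfl⟩
        exact hp.insert_isFlagOver ha hd hx

end Matroid

/-! ### Connectivity of flags in codimension one -/

namespace Matroid

variable {α : Type*} {M : Matroid α} {a p l q : Set α} {c f g : Set (Set α)} {d k : ℕ}
  {S : Set (Set (Set α))}

/-- Two flags of length `d` over `a` are joined by a ridge avoiding `S`: they share a chain of
`d - 1` flats that is contained in no member of `S`. -/
def FlagStep (M : Matroid α) (a : Set α) (d : ℕ) (S : Set (Set (Set α)))
    (f g : Set (Set α)) : Prop :=
  M.IsFlagOver a d f ∧ M.IsFlagOver a d g ∧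
    ∃ t : Set (Set α), t ⊆ f ∧ t ⊆ g ∧ t.encard + 1 = d ∧ ∀ s ∈ S, ¬ t ⊆ s

/-- The link of `S` at a cover `p` of `a`, as a family of flags over `p`. -/
def flagLink (M : Matroid α) (p : Set α) (k : ℕ) (S : Set (Set (Set α))) : Set (Set (Set α)) :=
  {s | M.IsFlagOver p k s ∧ insert p s ∈ S}

theorem encard_flagLink_le : (M.flagLink p k S).encard ≤ {s ∈ S | p ∈ s}.encard := by
  have hinj : Set.InjOn (insert p) (M.flagLink p k S) := by
    intro x hx y hy hxy
    rw [← Set.insert_sdiff_self_of_notMem hx.1.notMem, hxy,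
      Set.insert_sdiff_self_of_notMem hy.1.notMem]
  rw [← hinj.encard_image]
  refine Set.encard_le_encard ?_
  rintro _ ⟨s, hs, rfl⟩
  exact ⟨hs.2, Set.mem_insert p s⟩

variable [M.RankFinite]

theorem FlagStep.insert (ha : M.IsFlat a) (hp : M.FlatCovers a p)
    (hd : M.eRk a + (k + 2 : ℕ) = M.eRank) (hS : ∀ s ∈ S, M.IsFlagOver a (k + 1) s)
    (h : M.FlagStep p k (M.flagLink p k S) f g) :
    M.FlagStep a (k + 1) S (insert p f) (insert p g) := by
  obtain ⟨hf, hg, t, htf, htg, htk, ht⟩ := h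
  refine ⟨hp.insert_isFlagOver ha hd hf, hp.insert_isFlagOver ha hd hg, Insert.insert p t,
    Set.insert_subset_insert htf, Set.insert_subset_insert htg, ?_, fun s hs hts => ?_⟩
  · rw [Set.encard_insert_of_notMem fun h => hf.notMem (htf h), htk]
    norm_cast
  · have hps : p ∈ s := hts (Set.mem_insert p t)
    refine ht (s \ {p}) ⟨(hS s hs).sdiff_singleton ha hp hps, ?_⟩ fun F hF => ?_
    · rwa [Set.insert_sdiff_singleton, Set.insert_eq_of_mem hps]
    · exact ⟨hts (Set.mem_insert_of_mem p hF), fun h => hf.notMem (htf (h ▸ hF))⟩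

/-- The bottom member `p` of a flag can be exchanged for another cover `q` of `a`, along the ridge
formed by the rest `c` of the flag. -/
theorem flagStep_of_insert (ha : M.IsFlat a) (hp : M.FlatCovers a p) (hq : M.FlatCovers a q)
    (hd : M.eRk a + (k + 2 : ℕ) = M.eRank) (hcp : M.IsFlagOver p k c) (hcq : M.IsFlagOver q k c)
    (hS : ∀ s ∈ S, ¬ c ⊆ s) : M.FlagStep a (k + 1) S (insert p c) (insert q c) :=
  ⟨hp.insert_isFlagOver ha hd hcp, hq.insert_isFlagOver ha hd hcq, c, Set.subset_insert p c,
    Set.subset_insert q c, by rw [hcp.encard_eq]; norm_cast, hS⟩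

theorem reflTransGen_flagStep_insert (ha : M.IsFlat a) (hp : M.FlatCovers a p)
    (hd : M.eRk a + (k + 2 : ℕ) = M.eRank) (hS : ∀ s ∈ S, M.IsFlagOver a (k + 1) s)
    (h : Relation.ReflTransGen (M.FlagStep p k (M.flagLink p k S)) f g) :
    Relation.ReflTransGen (M.FlagStep a (k + 1) S) (insert p f) (insert p g) := by
  induction h with
  | refl => exact .refl
  | tail _ h ih => exact ih.tail (h.insert ha hp hd hS)

/-- If every flag over `l` extended by `l` lies in a member of `S`, then all members of `S` contain
`l`, because there are at least as many flags over `l` as members of `S`. -/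
theorem mem_of_forall_isFlagOver (hl : M.IsFlat l) (hd : M.eRk l + (k + 1 : ℕ) = M.eRank)
    (hS : ∀ s ∈ S, M.IsFlagOver a d s) (hcard : S.encard ≤ (k + 1 : ℕ))
    (h : ∀ c, M.IsFlagOver l k c → ∃ s ∈ S, insert l c ⊆ s) : ∀ s ∈ S, l ∈ s := by
  have hsub : {c | M.IsFlagOver l k c} ⊆ (fun s => {F ∈ s | l ⊂ F}) '' {s ∈ S | l ∈ s} := by
    intro c hc
    obtain ⟨s, hs, hcs⟩ := h c hc
    refine ⟨s, ⟨hs, hcs (Set.mem_insert l c)⟩, ?_⟩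
    have hfin : {F ∈ s | l ⊂ F}.Finite :=
      (Set.finite_of_encard_eq_coe (hS s hs).encard_eq).subset (Set.sep_subset _ _)
    have hcu : c ⊆ {F ∈ s | l ⊂ F} := fun F hF =>
      ⟨hcs (Set.mem_insert_of_mem l hF), hc.ssubset F hF⟩
    refine (hfin.eq_of_subset_of_encard_le' hcu ?_).symm
    have hu : M.IsFlagOver l {F ∈ s | l ⊂ F}.ncard {F ∈ s | l ⊂ F} :=
      ⟨fun F hF => (hS s hs).isFlat F hF.1, fun F hF => hF.2,
        fun F hF => (hS s hs).ne_ground F hF.1, (hS s hs).isChain.mono (Set.sep_subset _ _),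
        hfin.cast_ncard_eq.symm⟩
    rw [hu.encard_eq, hc.encard_eq]
    exact mod_cast hu.le_of_corank hl hd
  have hle : S.encard ≤ {s ∈ S | l ∈ s}.encard :=
    hcard.trans ((le_encard_isFlagOver hl hd).trans
      ((Set.encard_le_encard hsub).trans (Set.encard_image_le _ _)))
  have hSfin : S.Finite := Set.finite_of_encard_le_coe hcard
  have heq := hSfin.eq_of_subset_of_encard_le' (Set.sep_subset S (l ∈ ·)) hle
  intro s hs
  rw [← heq] at hs
  exact hs.2

/-- The complete flags over a flat of corank `d + 1` stay connected in codimension one when fewer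
than `d` flags are removed together with all ridges contained in one of them. -/
theorem reflTransGen_flagStep (ha : M.IsFlat a) (hd : M.eRk a + (d + 1 : ℕ) = M.eRank)
    (hS : ∀ s ∈ S, M.IsFlagOver a d s) (hcard : S.encard < d)
    (hf : M.IsFlagOver a d f) (hfS : f ∉ S) (hg : M.IsFlagOver a d g) (hgS : g ∉ S) :
    Relation.ReflTransGen (M.FlagStep a d S) f g := by
  induction d generalizing a f g S with
  | zero => simp at hcard
  | succ k ih =>
  rcases k with _ | k
  · -- the empty chain is a ridge of all flags
    have hS0 : S = ∅ := by simpa [Order.lt_one_iff] using hcard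
    subst hS0
    exact .single ⟨hf, hg, ∅, by simp, by simp, by simp, by simp⟩
  have hcard' : S.encard ≤ (k + 1 : ℕ) := by
    refine Order.le_of_lt_add_one ?_
    exact_mod_cast hcard
  have hSfin : S.Finite := Set.finite_of_encard_le_coe hcard'
  -- a cover of `a` is good if the induction hypothesis applies to its link
  let Good : Set α → Prop := fun p => M.FlatCovers a p ∧ {s ∈ S | p ∈ s}.encard < (k + 1 : ℕ)
  have good_conn : ∀ p f g, Good p → M.IsFlagOver a (k + 2) f → f ∉ S → p ∈ f →
      M.IsFlagOver a (k + 2) g → g ∉ S → p ∈ g →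
      Relation.ReflTransGen (M.FlagStep a (k + 2) S) f g := by
    intro p f g ⟨hp, hpS⟩ hf hfS hpf hg hgS hpg
    have hins : ∀ {x : Set (Set α)}, p ∈ x → insert p (x \ {p}) = x := fun h => by
      rw [Set.insert_sdiff_singleton, Set.insert_eq_of_mem h]
    rw [← hins hpf, ← hins hpg]
    refine reflTransGen_flagStep_insert ha hp hd hS (ih hp.isFlat (hp.corank ha hd)
      (fun s hs => hs.1) (encard_flagLink_le.trans_lt hpS) (hf.sdiff_singleton ha hp hpf)
      (fun h => hfS ?_) (hg.sdiff_singleton ha hp hpg) (fun h => hgS ?_))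
    · exact hins hpf ▸ h.2
    · exact hins hpg ▸ h.2
  -- a single ridge leads from any flag to a flag through a good cover
  have to_good : ∀ f, M.IsFlagOver a (k + 2) f → f ∉ S → ∃ q g, Good q ∧ q ∈ g ∧
      M.IsFlagOver a (k + 2) g ∧ g ∉ S ∧ Relation.ReflTransGen (M.FlagStep a (k + 2) S) f g ∧
      Relation.ReflTransGen (M.FlagStep a (k + 2) S) g f := by
    intro f hf hfS
    obtain ⟨p, hpf, hp⟩ := hf.exists_flatCovers_mem ha hd
    by_cases hgood : Good p
    · exact ⟨p, f, hgood, hpf, hf, hfS, .refl, .refl⟩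
    -- all members of `S` contain `p`, so every other cover is good
    have hall : ∀ s ∈ S, p ∈ s := by
      have hle : S.encard ≤ {s ∈ S | p ∈ s}.encard :=
        hcard'.trans (not_lt.1 fun h => hgood ⟨hp, h⟩)
      have heq := hSfin.eq_of_subset_of_encard_le' (Set.sep_subset S (p ∈ ·)) hle
      intro s hs
      rw [← heq] at hs
      exact hs.2
    have hc := hf.sdiff_singleton ha hp hpf
    have hfc : insert p (f \ {p}) = f := by
      rw [Set.insert_sdiff_singleton, Set.insert_eq_of_mem hpf]
    have hpd := hp.corank ha hd
    obtain ⟨l, hlc, hl⟩ := hc.exists_flatCovers_mem hp.isFlat hpd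
    obtain ⟨q, hqp, hq, hql⟩ := hp.exists_ne ha hl
    have hqS : ∀ s ∈ S, q ∉ s := fun s hs hqs =>
      hqp (hq.eq_of_mem_isChain ha hp (hS s hs).isChain hqs (hall s hs))
    have hcq : M.IsFlagOver q (k + 1) (f \ {p}) :=
      ⟨hc.isFlat, fun F hF => (hql.ssubset hq.isFlat).trans_subset
        (hl.subset_of_mem_isFlagOver hp.isFlat hc hlc hF), hc.ne_ground, hc.isChain, hc.encard_eq⟩
    have hridge : ∀ s ∈ S, ¬ f \ {p} ⊆ s := fun s hs hsub => by
      have hfs : f ⊆ s := hfc ▸ Set.insert_subset (hall s hs) hsub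
      have hfin : s.Finite := Set.finite_of_encard_eq_coe (hS s hs).encard_eq
      have := hfin.eq_of_subset_of_encard_le' hfs
        (by rw [hf.encard_eq, (hS s hs).encard_eq])
      exact hfS (this ▸ hs)
    have h1 := flagStep_of_insert ha hp hq hd hc hcq hridge
    have h2 := flagStep_of_insert ha hq hp hd hcq hc hridge
    rw [hfc] at h1 h2
    refine ⟨q, insert q (f \ {p}), ⟨hq, ?_⟩, Set.mem_insert _ _, h1.2.1,
      fun h => hqS _ h (Set.mem_insert _ _), .single h1, .single h2⟩
    have : {s ∈ S | q ∈ s} = ∅ := Set.eq_empty_of_forall_notMem fun s hs => hqS s hs.1 hs.2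
    rw [this, Set.encard_empty]
    exact mod_cast k.succ_pos
  -- two good covers are joined through their common cover `l` if some ridge through `l` survives
  have join : ∀ p q l c f g, Good p → Good q → M.FlatCovers p l → M.FlatCovers q l →
      M.IsFlagOver l k c → (∀ s ∈ S, ¬ insert l c ⊆ s) →
      M.IsFlagOver a (k + 2) f → f ∉ S → p ∈ f → M.IsFlagOver a (k + 2) g → g ∉ S → q ∈ g →
      Relation.ReflTransGen (M.FlagStep a (k + 2) S) f g := by
    intro p q l c f g hp hq hpl hql hc hcS hf hfS hpf hg hgS hqg
    have hpd := hp.1.corank ha hd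
    have hqd := hq.1.corank ha hd
    have hstep := flagStep_of_insert ha hp.1 hq.1 hd
      (hpl.insert_isFlagOver hp.1.isFlat hpd hc) (hql.insert_isFlagOver hq.1.isFlat hqd hc) hcS
    have hnot : ∀ x, insert x (insert l c) ∉ S := fun x h => hcS _ h (Set.subset_insert _ _)
    exact ((good_conn p f _ hp hf hfS hpf hstep.1 (hnot p) (Set.mem_insert _ _)).tail hstep).trans
      (good_conn q _ g hq hstep.2.1 (hnot q) (Set.mem_insert _ _) hg hgS hqg)
  obtain ⟨p, f', hp, hpf, hf', hfS', hff, -⟩ := to_good f hf hfS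
  obtain ⟨q, g', hq, hqg, hg', hgS', -, hgg⟩ := to_good g hg hgS
  refine hff.trans (Relation.ReflTransGen.trans ?_ hgg)
  by_cases hpq : p = q
  · subst hpq
    exact good_conn p f' g' hp hf' hfS' hpf hg' hgS' hqg
  obtain ⟨l, hpl, hql⟩ := hp.1.exists_join ha hq.1 hpq
  have hpd := hp.1.corank ha hd
  have hld := hpl.corank hp.1.isFlat hpd
  by_cases hex : ∃ c, M.IsFlagOver l k c ∧ ∀ s ∈ S, ¬ insert l c ⊆ s
  · obtain ⟨c, hc, hcS⟩ := hex
    exact join p q l c f' g' hp hq hpl hql hc hcS hf' hfS' hpf hg' hgS' hqg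
  -- otherwise all members of `S` contain `l`, and the path goes through a cover `t` not below `l`
  push Not at hex
  have hlS := mem_of_forall_isFlagOver hpl.isFlat hld hS hcard' hex
  have hal : a ⊂ l := (hp.1.ssubset ha).trans (hpl.ssubset hp.1.isFlat)
  obtain ⟨t, ht, htl⟩ := ha.exists_flatCovers_not_subset hpl.isFlat hal.subset
    (ne_ground_of_corank hld)
  -- a member of `S` through `m` also contains `l`, so `m ⊆ l` or `l ⊆ m`, but `m` does
  -- not lie below `l` because `t` does not, and `l ⊆ m` forces `l = m` because `m` covers `x`
  have hnotS : ∀ x m, M.FlatCovers a x → x ⊂ l → M.FlatCovers x m → t ⊆ m →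
      ∀ s ∈ S, m ∉ s := by
    intro x m hx hxl hxm htm s hs hms
    rcases (hS s hs).isChain.total (hlS s hs) hms with h | h
    · exact htl (hxm.eq_of_ssubset_of_subset hx.isFlat hpl.isFlat hxl h ▸ htm)
    · exact htl (htm.trans h)
  have htS : ∀ s ∈ S, t ∉ s := fun s hs hts => by
    have hlt := ht.subset_of_mem_isFlagOver ha (hS s hs) hts (hlS s hs)
    exact htl hlt
  have htgood : Good t := by
    refine ⟨ht, ?_⟩
    have : {s ∈ S | t ∈ s} = ∅ := Set.eq_empty_of_forall_notMem fun s hs => htS s hs.1 hs.2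
    rw [this, Set.encard_empty]
    exact mod_cast k.succ_pos
  obtain ⟨h, hh⟩ := exists_isFlagOver ht.isFlat (ht.corank ha hd)
  have hth := ht.insert_isFlagOver ha hd hh
  have hthS : insert t h ∉ S := fun hm => htS _ hm (Set.mem_insert _ _)
  have via : ∀ x, Good x → x ⊂ l → ∃ m c, M.FlatCovers x m ∧ M.FlatCovers t m ∧
      M.IsFlagOver m k c ∧ ∀ s ∈ S, ¬ insert m c ⊆ s := by
    intro x hx hxl
    obtain ⟨m, hxm, htm⟩ := hx.1.exists_join ha ht fun h => htl (h ▸ hxl.subset)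
    obtain ⟨c, hc⟩ := exists_isFlagOver hxm.isFlat (hxm.corank hx.1.isFlat (hx.1.corank ha hd))
    exact ⟨m, c, hxm, htm, hc, fun s hs hsub => hnotS x m hx.1 hxl hxm
      (htm.ssubset ht.isFlat).subset s hs (hsub (Set.mem_insert m c))⟩
  obtain ⟨m, c, hpm, htm, hc, hcS⟩ := via p hp (hpl.ssubset hp.1.isFlat)
  obtain ⟨m', c', hqm, htm', hc', hcS'⟩ := via q hq (hql.ssubset hq.1.isFlat)
  have htm_mem : t ∈ insert t h := Set.mem_insert t h
  exact (join p t m c f' _ hp htgood hpm htm hc hcS hf' hfS' hpf hth hthS htm_mem).trans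
    (join t q m' c' _ g' htgood hq htm' hqm hc' hcS' hth hthS htm_mem hg' hgS' hqg)

end Matroid

/-! ### Cones of chains of flats -/

namespace BergmanFan

open TropicalFan

variable {n d : ℕ} {M : Matroid (Fin (n + 1))} {c c' : Set (Set (Fin (n + 1)))}
  {F : Set (Fin (n + 1))}

theorem sub_eq_sub_of_proj_eq {w v : Fin (n + 1) → ℝ} (h : proj n w = proj n v)
    (i j : Fin (n + 1)) : w i - w j = v i - v j := by
  rw [proj, Submodule.mkQ_apply, Submodule.mkQ_apply, Submodule.Quotient.eq,
    Submodule.mem_span_singleton] at h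
  obtain ⟨t, ht⟩ := h
  have hi := congrFun ht i
  have hj := congrFun ht j
  simp only [Pi.smul_apply, Pi.one_apply, Pi.sub_apply] at hi hj
  linarith

/-- The cone of a chain contains no ray `e_F` other than those of the members of the chain. -/
theorem mem_of_ray_mem_chainCone (hc : IsChain (· ⊆ ·) c) (hne : F.Nonempty)
    (hF : F ≠ Set.univ) (h : ray F ∈ chainCone c) : F ∈ c := by
  obtain ⟨w, hw, hsep⟩ := exists_separating h
  -- any element of `F` is separated from any element outside `F` by a member of the chain
  have hsep' : ∀ i ∉ F, ∀ j ∈ F, ∃ G ∈ c, j ∈ G ∧ i ∉ G := fun i hi j hj => by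
    refine hsep i j ?_
    have := sub_eq_sub_of_proj_eq hw i j
    simp only [Set.indicator_of_notMem hi, Set.indicator_of_mem hj, Pi.one_apply] at this
    linarith
  obtain ⟨i₀, hi₀⟩ := (Set.ne_univ_iff_exists_notMem F).1 hF
  have hin : ∀ i ∉ F, ∃ G ∈ c, F ⊆ G ∧ i ∉ G := fun i hi => by
    obtain ⟨j₀, hj₀⟩ := hne
    have hfin : {G ∈ c | i ∉ G}.Finite := Set.toFinite _
    obtain ⟨G₀, hG₀, -, hi'⟩ := hsep' i hi j₀ hj₀
    obtain ⟨G, hG⟩ := hfin.exists_maximal ⟨G₀, hG₀, hi'⟩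
    refine ⟨G, hG.prop.1, fun j hj => ?_, hG.prop.2⟩
    obtain ⟨K, hK, hjK, hiK⟩ := hsep' i hi j hj
    rcases hc.total hG.prop.1 hK with h | h
    · exact hG.le_of_ge ⟨hK, hiK⟩ h hjK
    · exact h hjK
  have hfin : {G ∈ c | F ⊆ G}.Finite := Set.toFinite _
  obtain ⟨G₀, hG₀, hFG₀, -⟩ := hin i₀ hi₀
  obtain ⟨G, hG⟩ := hfin.exists_minimal ⟨G₀, hG₀, hFG₀⟩
  have hGF : G ⊆ F := fun i hi => by
    by_contra hiF
    obtain ⟨K, hK, hFK, hiK⟩ := hin i hiF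
    rcases hc.total hG.prop.1 hK with h | h
    · exact hiK (h hi)
    · exact hiK (hG.le_of_le ⟨hK, hFK⟩ h hi)
  exact hGF.antisymm hG.prop.2 ▸ hG.prop.1

theorem chainCone_le_iff (hE : M.E = Set.univ) (hc : IsFlatChain M c) (hc' : IsFlatChain M c') :
    chainCone c ≤ chainCone c' ↔ c ⊆ c' := by
  refine ⟨fun h F hF => ?_, fun h => Submodule.span_mono (Set.image_mono h)⟩
  exact mem_of_ray_mem_chainCone hc'.2 (hc.1 F hF).2.1 (hE ▸ (hc.1 F hF).2.2)
    (h (PointedCone.subset_hull ⟨F, hF, rfl⟩))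

theorem chainCone_injOn (hE : M.E = Set.univ) : Set.InjOn chainCone {c | IsFlatChain M c} :=
  fun _ hc _ hc' h => ((chainCone_le_iff hE hc hc').1 h.le).antisymm
    ((chainCone_le_iff hE hc' hc).1 h.ge)

/-- The ray of a proper set is independent of the rays of the members of a chain of strictly
smaller sets: some coordinate difference separates them. -/
theorem ray_notMem_span (hc : IsChain (· ⊆ ·) c) (hcF : ∀ G ∈ c, G ⊂ F) (hne : F.Nonempty)
    (hF : F ≠ Set.univ) : ray F ∉ Submodule.span ℝ (ray '' c) := by
  obtain ⟨i, hi⟩ := (Set.ne_univ_iff_exists_notMem F).1 hF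
  obtain ⟨j, hjF, hj⟩ : ∃ j ∈ F, ∀ G ∈ c, j ∉ G := by
    rcases c.eq_empty_or_nonempty with rfl | hcne
    · exact ⟨hne.some, hne.some_mem, by simp⟩
    · obtain ⟨G, hG⟩ := c.toFinite.exists_maximal hcne
      obtain ⟨j, hjF, hjG⟩ := Set.exists_of_ssubset (hcF G hG.prop)
      refine ⟨j, hjF, fun K hK hjK => hjG ?_⟩
      rcases hc.total hG.prop hK with h | h
      · exact hG.le_of_ge hK h hjK
      · exact h hjK
  let φ : (Fin (n + 1) → ℝ) →ₗ[ℝ] ℝ :=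
    LinearMap.proj (R := ℝ) (φ := fun _ => ℝ) j - LinearMap.proj (R := ℝ) (φ := fun _ => ℝ) i
  have hle : Submodule.span ℝ (ray '' c) ≤ (LinearMap.ker φ).map (proj n) := by
    rw [Submodule.span_le]
    rintro _ ⟨G, hG, rfl⟩
    refine ⟨G.indicator 1, ?_, rfl⟩
    have hiG : i ∉ G := fun h => hi ((hcF G hG).subset h)
    simp [φ, hj G hG, hiG]
  intro h
  obtain ⟨w, hw, hwF⟩ := hle h
  have h1 := sub_eq_sub_of_proj_eq hwF j i
  have h2 : w j - w i = 0 := by simpa [φ] using hw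
  simp [h2, hi, hjF] at h1

theorem linearIndepOn_ray (hc : IsChain (· ⊆ ·) c) (hne : ∀ F ∈ c, F.Nonempty)
    (huniv : ∀ F ∈ c, F ≠ Set.univ) : LinearIndepOn ℝ ray c := by
  induction hk : c.ncard generalizing c with
  | zero =>
    rw [Set.ncard_eq_zero] at hk
    subst hk
    exact linearIndepOn_empty ℝ ray
  | succ k ih =>
    have hcne : c.Nonempty := by
      rw [← Set.ncard_pos]
      omega
    obtain ⟨F, hF⟩ := c.toFinite.exists_maximal hcne
    rw [← Set.insert_eq_of_mem hF.prop, ← Set.insert_sdiff_singleton,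
      linearIndepOn_insert (fun h => h.2 rfl)]
    have hc' : IsChain (· ⊆ ·) (c \ {F}) := hc.mono Set.sdiff_subset
    refine ⟨ih hc' (fun G hG => hne G hG.1) (fun G hG => huniv G hG.1) ?_,
      ray_notMem_span hc' (fun G hG => ?_) (hne F hF.prop) (huniv F hF.prop)⟩
    · rw [Set.ncard_sdiff_singleton_of_mem hF.prop, hk]
      rfl
    · rcases hc.total hG.1 hF.prop with h | h
      · exact h.ssubset_of_ne hG.2
      · exact absurd ((hF.le_of_ge hG.1 h).antisymm h) hG.2

theorem coneDim_chainCone (hE : M.E = Set.univ) (hc : IsFlatChain M c) :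
    coneDim (chainCone c) = c.ncard := by
  have hli := linearIndepOn_ray hc.2 (fun F hF => (hc.1 F hF).2.1)
    (fun F hF => hE ▸ (hc.1 F hF).2.2)
  have : Fintype c := Fintype.ofFinite c
  rw [coneDim, chainCone, PointedCone.hull, Submodule.span_span_of_tower]
  have := finrank_span_eq_card hli.linearIndependent
  rw [Set.ncard_eq_toFinset_card', Set.toFinset_card, ← this, Set.image_eq_range]

theorem isFlagOver_empty_iff : M.IsFlagOver ∅ d c ↔ IsFlatChain M c ∧ c.ncard = d := by
  constructor
  · intro h
    refine ⟨⟨fun F hF => ⟨h.isFlat F hF, ?_, h.ne_ground F hF⟩, h.isChain⟩, ?_⟩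
    · exact Set.empty_ssubset.1 (h.ssubset F hF)
    · rw [Set.ncard, h.encard_eq]
      rfl
  · rintro ⟨h, rfl⟩
    exact ⟨fun F hF => (h.1 F hF).1, fun F hF => Set.empty_ssubset.2 (h.1 F hF).2.1,
      fun F hF => (h.1 F hF).2.2, h.2, c.toFinite.cast_ncard_eq.symm⟩

theorem fineSubdivision_eq_image [M.Loopless] :
    fineSubdivision M = chainCone '' {c | IsFlatChain M c} := by
  ext σ
  constructor
  · rintro ⟨c, hc, rfl, -⟩
    exact ⟨c, hc, rfl⟩
  · rintro ⟨c, hc, rfl⟩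
    exact ⟨c, hc, rfl, chainCone_subset_trop M hc⟩

/-- If `M` has a loop then its Bergman fan is empty, so no cone lies in it. -/
theorem fineSubdivision_eq_empty (h : ¬ M.Loopless) : fineSubdivision M = ∅ := by
  rw [Set.eq_empty_iff_forall_notMem]
  rintro σ ⟨c, -, -, hσ⟩
  obtain ⟨w, hw, -⟩ := hσ (zero_mem σ)
  refine h (Matroid.loopless_iff_forall_isCircuit.2 fun C hC => ?_)
  obtain ⟨i, hi, j, hj, hij, -⟩ := hw C hC
  exact ⟨i, hi, j, hj, hij⟩

theorem isFlat_empty [M.Loopless] : M.IsFlat ∅ := by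
  rw [Matroid.isFlat_iff_closure_eq]
  exact M.loops_eq_empty

theorem fanDim_fineSubdivision [M.Loopless] (hE : M.E = Set.univ)
    (hd : M.eRk ∅ + (d + 1 : ℕ) = M.eRank) : fanDim (fineSubdivision M) = d := by
  have hdim : coneDim '' fineSubdivision M = Set.ncard '' {c | IsFlatChain M c} := by
    rw [fineSubdivision_eq_image, Set.image_image]
    exact Set.image_congr fun c hc => coneDim_chainCone hE hc
  rw [fanDim, hdim]
  refine IsGreatest.csSup_eq ⟨?_, ?_⟩
  · obtain ⟨c, hc⟩ := Matroid.exists_isFlagOver isFlat_empty hd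
    exact ⟨c, isFlagOver_empty_iff.1 hc⟩
  · rintro _ ⟨c, hc, rfl⟩
    exact (isFlagOver_empty_iff.2 ⟨hc, rfl⟩).le_of_corank isFlat_empty hd

theorem facets_fineSubdivision [M.Loopless] (hE : M.E = Set.univ)
    (hd : M.eRk ∅ + (d + 1 : ℕ) = M.eRank) :
    facets (fineSubdivision M) = chainCone '' {c | M.IsFlagOver ∅ d c} := by
  ext σ
  rw [facets, fanDim_fineSubdivision hE hd, fineSubdivision_eq_image]
  simp only [isFlagOver_empty_iff]
  constructor
  · rintro ⟨⟨c, hc, rfl⟩, h⟩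
    exact ⟨c, ⟨hc, coneDim_chainCone hE hc ▸ h⟩, rfl⟩
  · rintro ⟨c, ⟨hc, h⟩, rfl⟩
    exact ⟨⟨c, hc, rfl⟩, (coneDim_chainCone hE hc).trans h⟩

theorem adj_removeVertices_of_flagStep [M.Loopless] (hE : M.E = Set.univ)
    (hd : M.eRk ∅ + (d + 1 : ℕ) = M.eRank) {S : Set (PointedCone ℝ (Space n))}
    (hS : S ⊆ facets (fineSubdivision M)) {f g : Set (Set (Fin (n + 1)))}
    (h : M.FlagStep ∅ d {c | M.IsFlagOver ∅ d c ∧ chainCone c ∈ S} f g) :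
    ((facetRidgeHypergraph (fineSubdivision M)).removeVertices S).Adj
      (chainCone f) (chainCone g) := by
  obtain ⟨hf, hg, t, htf, htg, htd, ht⟩ := h
  have hf' := (isFlagOver_empty_iff.1 hf).1
  have htc : IsFlatChain M t := ⟨fun F hF => hf'.1 F (htf hF), hf'.2.mono htf⟩
  have hfac : ∀ {x}, M.IsFlagOver ∅ d x → chainCone x ∈ facets (fineSubdivision M) :=
    fun hx => facets_fineSubdivision hE hd ▸ ⟨_, hx, rfl⟩
  refine ⟨{σ | σ ∈ facets (fineSubdivision M) ∧ chainCone t ≤ σ}, ⟨⟨chainCone t, ⟨?_, ?_⟩, rfl⟩, ?_⟩,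
    ⟨hfac hf, Submodule.span_mono (Set.image_mono htf)⟩,
    ⟨hfac hg, Submodule.span_mono (Set.image_mono htg)⟩⟩
  · exact ⟨t, htc, rfl, chainCone_subset_trop M htc⟩
  · rw [coneDim_chainCone hE htc, fanDim_fineSubdivision hE hd]
    rw [← t.toFinite.cast_ncard_eq] at htd
    exact_mod_cast htd
  · rw [Set.disjoint_left]
    rintro σ ⟨-, hσ⟩ hσS
    have hσf := hS hσS
    rw [facets_fineSubdivision hE hd] at hσf
    obtain ⟨s, hs, rfl⟩ := hσf
    exact ht s ⟨hs, hσS⟩ ((chainCone_le_iff hE htc (isFlagOver_empty_iff.1 hs).1).1 hσ)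

end BergmanFan

theorem proposition4p1 (n d : ℕ) (M : Matroid (Fin (n + 1))) (hE : M.E = Set.univ)
    (hrank : M.eRank = ((d + 1 : ℕ) : ℕ∞)) :
    (TropicalFan.facetRidgeHypergraph (BergmanFan.fineSubdivision M)).IsKConnected d := by
  intro S hS hcard σ hσ τ hτ
  by_cases hM : M.Loopless
  · have hd : M.eRk ∅ + (d + 1 : ℕ) = M.eRank := by simp [hrank]
    have hS' : S ⊆ TropicalFan.facets (BergmanFan.fineSubdivision M) := hS
    have hσf : σ ∈ TropicalFan.facets (BergmanFan.fineSubdivision M) := hσ.1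
    have hτf : τ ∈ TropicalFan.facets (BergmanFan.fineSubdivision M) := hτ.1
    rw [BergmanFan.facets_fineSubdivision hE hd] at hσf hτf
    obtain ⟨f, hf, rfl⟩ := hσf
    obtain ⟨g, hg, rfl⟩ := hτf
    have hcard' : {c | M.IsFlagOver ∅ d c ∧ BergmanFan.chainCone c ∈ S}.encard < d := by
      refine lt_of_le_of_lt (Set.encard_le_encard_of_injOn (fun c hc => hc.2) ?_) hcard
      exact (BergmanFan.chainCone_injOn hE).mono fun c hc =>
        (BergmanFan.isFlagOver_empty_iff.1 hc.1).1
    exact (Matroid.reflTransGen_flagStep BergmanFan.isFlat_empty hd (fun s hs => hs.1) hcard'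
      hf (fun h => hσ.2 h.2) hg (fun h => hτ.2 h.2)).lift BergmanFan.chainCone fun _ _ =>
        BergmanFan.adj_removeVertices_of_flagStep hE hd hS'
  · -- with a loop the fan has no cones at all
    have hσf : σ ∈ BergmanFan.fineSubdivision M := hσ.1.1
    simp [BergmanFan.fineSubdivision_eq_empty hM] at hσf
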